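/- \textbf{Setting.} Let $U$ be a compact metric space, $Y\subset\mathbb R^m$ and $Z\subset\mathbb R^n$ compact, $C>0$, $z_0\in Z$, and let $f:U\times\mathbb R^m\times\mathbb R^n\to\mathbb R^m$, $g:U\times\mathbb R^m\times\mathbb R^n\to\mathbb R^n$, $G:U\times\mathbb R^m\times\mathbb R^n\to\mathbb R$ be continuous. $\mathcal P(X)$ denotes the Borel probability measures on $X$ with the weak$^*$ topology. Absolute continuity on $[0,\infty)$ means absolute continuity on every $[0,T]$. For $z\in Z$, an \emph{admissible pair of the associated system} is a measurable $u:[0,\infty)\to U$ and an absolutely continuous $y:[0,\infty)\to Y$ with $y'(\tau)=f(u(\tau),y(\tau),z)$ for a.a. $\tau\ge 0$. Let $$W(z)=\Big\{\mu\in\mathcal P(U\times Y):\int \nabla\phi(y)^Tf(u,y,z)\,\mu(du,dy)=0\ \ \forall \phi\in C^1(\mathbb R^m)\Big\},\qquad F=\{(\mu,z):z\in Z,\ \mu\in W(z)\},$$ $\tilde g(\mu,z)=\int g(u,y,z)\,\mu(du,dy)$ and $\tilde G(\mu,z)=\int G(u,y,z)\,\mu(du,dy)$. An \emph{admissible pair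 of the averaged system} is a measurable $\mu:[0,\infty)\to\mathcal P(U\times Y)$ and an absolutely continuous $z:[0,\infty)\to Z$ with $\mu(t)\in W(z(t))$ and $z'(t)=\tilde g(\mu(t),z(t))$ for a.a. $t\ge0$. Let $\tilde V^*(z_0)$ be the infimum of $\int_0^\infty e^{-Ct}\tilde G(\mu(t),z(t))\,dt$ over the admissible pairs of the averaged system with $z(0)=z_0$, and let $\tilde G^*(z_0)$ be the minimum of $\int_F\tilde G\,dp$ over all $p\in\mathcal P(F)$ such that $\int_F\big(\nabla\psi(z)^T\tilde g(\mu,z)+C(\psi(z_0)-\psi(z))\big)\,p(d\mu,dz)=0$ for all $\psi\in C^1(\mathbb R^n)$. Put $\tilde H(q,z)=\min_{\mu\in W(z)}\{\tilde G(\mu,z)+q^T\tilde g(\mu,z)\}$. A function $\zeta^*\in C^1(\mathbb R^n)$ is a \emph{solution of the averaged dual problem} if $\tilde G^*(z_0)\le\tilde H(\nabla\zeta^*(z),z)+C(\zeta^*(z_0)-\zeta^*(z))$ for all $z\in Z$. Given $\zeta^*$ and $z\in Z$, a function $\eta^*_z\in C^1(\mathbb R^m)$ is a \emph{solution of the associated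 dual problem} at $z$ if $\tilde H(\nabla\zeta^*(z),z)\le G(u,y,z)+\nabla\zeta^*(z)^Tg(u,y,z)+\nabla\eta_z^*(y)^Tf(u,y,z)$ for all $(u,y)\in U\times Y$. An \emph{average control generating (ACG) family} assigns to each $z\in Z$ an admissible pair $(u_z(\cdot),y_z(\cdot))$ of the associated system such that: (i) each pair generates an occupational measure $\mu(\cdot|z)\in\mathcal P(U\times Y)$ on $[0,\infty)$, i.e. $\frac1S\int_0^Sq(u_z(\tau),y_z(\tau))\,d\tau\to\int q\,d\mu(\cdot|z)$ as $S\to\infty$ for all $q\in C(U\times Y)$; (ii) for every $q\in C(U\times Y\times Z)$ the function $z\mapsto\int q(u,y,z)\,\mu(du,dy|z)$ is Borel measurable on $Z$ and there is $\phi_q$ with $\phi_q(S)\to0$ as $S\to\infty$ and $\big|\frac1S\int_0^Sq(u_z(\tau),y_z(\tau),z)\,d\tau-\int q(u,y,z)\,\mu(du,dy|z)\big|\le\phi_q(S)$ for all $S>0$, $z\in Z$; (iii) the equation $z'(t)=\tilde g(\mu(\cdot|z(t)),z(t))$, $z(0)=z_0$, has a unique absolutely continuous solution $z(\cdot)$ on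 $[0,\infty)$ with values in $Z$ (the equation being understood for a.a. $t$). The family is \emph{optimal} if $\int_0^\infty e^{-Ct}\tilde G(\mu(\cdot|z(t)),z(t))\,dt=\tilde V^*(z_0)$. \textbf{Proposition.} Assume that $C\,\tilde V^*(z_0)=\tilde G^*(z_0)$, that $\zeta^*$ is a solution of the averaged dual problem and that, for every $z\in Z$, $\eta^*_z$ is a solution of the associated dual problem at $z$. Let $(u_z(\cdot),y_z(\cdot))$ be an optimal ACG family, with corresponding solution $z(\cdot)$ of the equation in (iii), that is periodic: $(u_z(\tau+T_z),y_z(\tau+T_z))=(u_z(\tau),y_z(\tau))$ for all $\tau\ge0$, with some $T_z>0$ (it suffices that this holds for $z=z(t)$, $t\ge0$). Then, for almost all $t\in[0,\infty)$ and almost all $\tau\in[0,T_{z(t)}]$, $$u_{z(t)}(\tau)\in\operatorname*{Argmin}_{u\in U}\Big\{G(u,y_{z(t)}(\tau),z(t))+\nabla\zeta^*(z(t))^Tg(u,y_{z(t)}(\tau),z(t))+\nabla\eta^*_{z(t)}(y_{z(t)}(\tau))^Tf(u,y_{z(t)}(\tau),z(t))\Big\}.$$ -/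

import Mathlib

open MeasureTheory Set Filter Topology

noncomputable section

namespace SlowFast

/-- Euclidean space `ℝᵏ`. -/
abbrev E (k : ℕ) : Type := EuclideanSpace ℝ (Fin k)

/-- The data of the singularly perturbed discounted problem
`ε y' = f(u,y,z)`, `z' = g(u,y,z)`, with running cost `G` and discount rate `C > 0`, where the
controls are `U`-valued and the fast and slow state variables live in the compact sets
`Y ⊆ ℝᵐ` and `Z ⊆ ℝⁿ`. -/
structure Problem (U : Type*) [TopologicalSpace U] (m n : ℕ) where
  Y : Set (E m)
  Z : Set (E n)
  isCompact_Y : IsCompact Y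
  isCompact_Z : IsCompact Z
  f : U → E m → E n → E m
  g : U → E m → E n → E n
  G : U → E m → E n → ℝ
  continuous_f : Continuous fun x : U × E m × E n => f x.1 x.2.1 x.2.2
  continuous_g : Continuous fun x : U × E m × E n => g x.1 x.2.1 x.2.2
  continuous_G : Continuous fun x : U × E m × E n => G x.1 x.2.1 x.2.2
  C : ℝ
  C_pos : 0 < C

/-- `x` is absolutely continuous on every interval `[0, T]` and `x'(t) = v(t)` for almost all
`t ≥ 0`. -/
def IsACSolution {k : ℕ} (x v : ℝ → E k) : Prop :=
  (∀ T : ℝ, 0 ≤ T → AbsolutelyContinuousOnInterval x 0 T) ∧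
    ∀ᵐ t ∂(volume.restrict (Ici (0 : ℝ))), HasDerivAt x (v t) t

variable {U : Type*} [MetricSpace U] [MeasurableSpace U] [BorelSpace U] {m n : ℕ}

namespace Problem

/-- Admissible pair (on `[0, ∞)`) of the associated system `y'(τ) = f(u(τ), y(τ), z)` with
frozen `z`. The values of `u`, `y` at negative times are irrelevant. -/
def IsAssociatedAdmissible (P : Problem U m n) (z : P.Z) (u : ℝ → U) (y : ℝ → P.Y) : Prop :=
  AEMeasurable u (volume.restrict (Ici (0 : ℝ))) ∧
    IsACSolution (fun τ => (y τ : E m)) (fun τ => P.f (u τ) (y τ) z)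

/-- The set `W(z)` of probability measures `μ` on `U × Y` with
`∫ ∇φ(y)ᵀ f(u,y,z) μ(du,dy) = 0` for all `φ ∈ C¹(ℝᵐ)`. -/
def W (P : Problem U m n) (z : P.Z) : Set (ProbabilityMeasure (U × P.Y)) :=
  {μ | ∀ φ : E m → ℝ, ContDiff ℝ 1 φ →
    ∫ w, inner ℝ (gradient φ (w.2 : E m)) (P.f w.1 w.2 z) ∂(μ : Measure (U × P.Y)) = 0}

/-- `g̃(μ, z) = ∫ g(u,y,z) μ(du,dy)`. -/
def gTilde (P : Problem U m n) (μ : ProbabilityMeasure (U × P.Y)) (z : P.Z) : E n :=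
  ∫ w, P.g w.1 w.2 z ∂(μ : Measure (U × P.Y))

/-- `G̃(μ, z) = ∫ G(u,y,z) μ(du,dy)`. -/
def GTilde (P : Problem U m n) (μ : ProbabilityMeasure (U × P.Y)) (z : P.Z) : ℝ :=
  ∫ w, P.G w.1 w.2 z ∂(μ : Measure (U × P.Y))

/-- Admissible pair (on `[0, ∞)`) of the averaged system `z' = g̃(μ(t), z(t))`,
`μ(t) ∈ W(z(t))`, `z(t) ∈ Z`. -/
def IsAveragedAdmissible (P : Problem U m n) (μ : ℝ → ProbabilityMeasure (U × P.Y))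
    (z : ℝ → P.Z) : Prop :=
  AEMeasurable μ (volume.restrict (Ici (0 : ℝ))) ∧
    (∀ᵐ t ∂(volume.restrict (Ici (0 : ℝ))), μ t ∈ P.W (z t)) ∧
    IsACSolution (fun t => (z t : E n)) (fun t => P.gTilde (μ t) (z t))

/-- The discounted cost `∫₀^∞ e^{-Ct} G̃(μ(t), z(t)) dt`. -/
def averagedCost (P : Problem U m n) (μ : ℝ → ProbabilityMeasure (U × P.Y)) (z : ℝ → P.Z) : ℝ :=
  ∫ t in Ici (0 : ℝ), Real.exp (-P.C * t) * P.GTilde (μ t) (z t)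

/-- The optimal value of the averaged problem: the infimum of the discounted cost over the
admissible pairs of the averaged system starting at `z₀`. -/
def averagedValue (P : Problem U m n) (z₀ : P.Z) : ℝ :=
  sInf {J | ∃ (μ : ℝ → ProbabilityMeasure (U × P.Y)) (z : ℝ → P.Z),
    P.IsAveragedAdmissible μ z ∧ z 0 = z₀ ∧ J = P.averagedCost μ z}

/-- The graph `F` of `W(·)`, a subset of `𝒫(U × Y) × Z`. -/
def graphW (P : Problem U m n) : Set (ProbabilityMeasure (U × P.Y) × P.Z) :=
  {x | x.1 ∈ P.W x.2}

/-- The feasible set of the averaged infinite-dimensional LP problem: probability measures `p`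
on `F` with `∫ (∇ψ(z)ᵀ g̃(μ,z) + C (ψ(z₀) - ψ(z))) p(dμ,dz) = 0` for all `ψ ∈ C¹(ℝⁿ)`. -/
def averagedLPFeasible (P : Problem U m n) (z₀ : P.Z) : Set (ProbabilityMeasure P.graphW) :=
  {p | ∀ ψ : E n → ℝ, ContDiff ℝ 1 ψ →
    ∫ x, (inner ℝ (gradient ψ (x.1.2 : E n)) (P.gTilde x.1.1 x.1.2)
      + P.C * (ψ z₀ - ψ x.1.2)) ∂(p : Measure P.graphW) = 0}

/-- The optimal value of the averaged infinite-dimensional LP problem. -/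
def averagedLPValue (P : Problem U m n) (z₀ : P.Z) : ℝ :=
  sInf ((fun p : ProbabilityMeasure P.graphW =>
    ∫ x, P.GTilde x.1.1 x.1.2 ∂(p : Measure P.graphW)) '' P.averagedLPFeasible z₀)

/-- The Hamiltonian of the averaged system,
`H̃(q, z) = min_{μ ∈ W(z)} (G̃(μ,z) + qᵀ g̃(μ,z))`. -/
def HTilde (P : Problem U m n) (q : E n) (z : P.Z) : ℝ :=
  sInf ((fun μ => P.GTilde μ z + inner ℝ q (P.gTilde μ z)) '' P.W z)

/-- `ζ` is a (continuously differentiable) solution of the averaged dual problem. -/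
def IsAveragedDualSolution (P : Problem U m n) (z₀ : P.Z) (ζ : E n → ℝ) : Prop :=
  ContDiff ℝ 1 ζ ∧
    ∀ z : P.Z, P.averagedLPValue z₀ ≤ P.HTilde (gradient ζ (z : E n)) z + P.C * (ζ z₀ - ζ z)

/-- The expression `G(u,y,z) + ∇ζ(z)ᵀ g(u,y,z) + ∇η(y)ᵀ f(u,y,z)`. -/
def dualIntegrand (P : Problem U m n) (ζ : E n → ℝ) (η : E m → ℝ) (u : U) (y : E m) (z : E n) :
    ℝ :=
  P.G u y z + inner ℝ (gradient ζ z) (P.g u y z) + inner ℝ (gradient η y) (P.f u y z)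

/-- `η` is a (continuously differentiable) solution of the associated dual problem at `z`
(the problem being defined by `ζ`). -/
def IsAssociatedDualSolution (P : Problem U m n) (ζ : E n → ℝ) (z : P.Z) (η : E m → ℝ) : Prop :=
  ContDiff ℝ 1 η ∧
    ∀ (u : U) (y : P.Y), P.HTilde (gradient ζ (z : E n)) z ≤ P.dualIntegrand ζ η u y z

/-- `μ` is the occupational measure generated by `(u(·), y(·))` on `[0, ∞)`. -/
def IsOccupationalMeasure (P : Problem U m n) (u : ℝ → U) (y : ℝ → P.Y)
    (μ : ProbabilityMeasure (U × P.Y)) : Prop :=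
  ∀ q : C(U × P.Y, ℝ),
    Tendsto (fun S : ℝ => S⁻¹ * ∫ τ in (0 : ℝ)..S, q (u τ, y τ)) atTop
      (𝓝 (∫ w, q w ∂(μ : Measure (U × P.Y))))

/-- `z(·)` is a solution on `[0, ∞)`, with values in `Z`, of
`z'(t) = g̃(μ(·|z(t)), z(t))`, `z(0) = z₀`. -/
def IsAveragedTrajectory (P : Problem U m n) (z₀ : P.Z)
    (μ : P.Z → ProbabilityMeasure (U × P.Y)) (z : ℝ → P.Z) : Prop :=
  z 0 = z₀ ∧ IsACSolution (fun t => (z t : E n)) (fun t => P.gTilde (μ (z t)) (z t))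

/-- `(u_z(·), y_z(·))`, `z ∈ Z`, is an average control generating (ACG) family, `μ(·|z)` is the
family of occupational measures it generates, and `z(·)` (here `zt`) is the corresponding unique
solution of the averaged equation. -/
structure IsACGFamily (P : Problem U m n) (z₀ : P.Z) (u : P.Z → ℝ → U) (y : P.Z → ℝ → P.Y)
    (μ : P.Z → ProbabilityMeasure (U × P.Y)) (zt : ℝ → P.Z) : Prop where
  admissible : ∀ z, P.IsAssociatedAdmissible z (u z) (y z)
  occupational : ∀ z, P.IsOccupationalMeasure (u z) (y z) (μ z)
  measurable : ∀ q : C(U × P.Y × P.Z, ℝ),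
    Measurable fun z => ∫ w, q (w.1, w.2, z) ∂(μ z : Measure (U × P.Y))
  uniform : ∀ q : C(U × P.Y × P.Z, ℝ), ∃ φ : ℝ → ℝ, Tendsto φ atTop (𝓝 0) ∧
    ∀ S : ℝ, 0 < S → ∀ z : P.Z,
      |S⁻¹ * (∫ τ in (0 : ℝ)..S, q (u z τ, y z τ, z))
        - ∫ w, q (w.1, w.2, z) ∂(μ z : Measure (U × P.Y))| ≤ φ S
  solution : P.IsAveragedTrajectory z₀ μ zt
  unique : ∀ zt' : ℝ → P.Z, P.IsAveragedTrajectory z₀ μ zt' → EqOn zt' zt (Ici 0)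

/-- Optimality of an ACG family: the generated pair `(μ(·|z(·)), z(·))` attains the optimal value
of the averaged problem. -/
def IsOptimalACG (P : Problem U m n) (z₀ : P.Z) (μ : P.Z → ProbabilityMeasure (U × P.Y))
    (zt : ℝ → P.Z) : Prop :=
  P.averagedCost (fun t => μ (zt t)) zt = P.averagedValue z₀

end Problem

/-- `(u(·), y(·))` is `T`-periodic on `[0, ∞)`, `T > 0`. -/
def IsPeriodicPair {A B : Type*} (T : ℝ) (u : ℝ → A) (y : ℝ → B) : Prop :=
  0 < T ∧ ∀ τ : ℝ, 0 ≤ τ → u (τ + T) = u τ ∧ y (τ + T) = y τ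

end SlowFast

end

namespace SlowFast

/-! Two families of inequalities are forced to be equalities. Along `zt`, duality and `μ(·|z) ∈
W(z)` give `C V ≤ H̃ + C(ζ(z₀) - ζ(z)) ≤ G̃ + ∇ζᵀg̃ + C(ζ(z₀) - ζ(z))`. Against the weight
`e^{-Ct}`, optimality gives both ends the same integral `V`, since the `ζ` terms form a total
derivative and integrate to zero. Hence for a.e. `t` the occupational measure attains `H̃`
(`IsACGFamily.ae_HTilde_eq`). Fix such a `t` and set `z = z(t)`. The dual integrand is at least `H̃`
on `U × Y`, and its mean under `μ(·|z)` is `H̃`, because `∇ηᵀf` integrates to zero over any element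
of `W(z)`. By periodicity this mean is the average over one period, so the bound is attained for
a.e. `τ` (`IsOccupationalMeasure.ae_isMinOn`). The bound holds for all controls, so attaining it is
minimality. -/

theorem _root_.ContDiff.continuous_gradient {k : ℕ} {φ : E k → ℝ} (hφ : ContDiff ℝ 1 φ) :
    Continuous (gradient φ) :=
  (InnerProductSpace.toDual ℝ (E k)).symm.continuous.comp (hφ.continuous_fderiv one_ne_zero)

/-- The composition of a `C¹` function with an absolutely continuous curve is absolutely
continuous. -/
theorem _root_.AbsolutelyContinuousOnInterval.contDiff_comp {k : ℕ} {φ : E k → ℝ}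
    (hφ : ContDiff ℝ 1 φ) {x : ℝ → E k} {a b : ℝ} (hx : AbsolutelyContinuousOnInterval x a b) :
    AbsolutelyContinuousOnInterval (fun t => φ (x t)) a b := by
  obtain ⟨R, hR⟩ := hx.exists_bound
  obtain ⟨K, hK⟩ := (hφ.contDiffOn (s := Metric.closedBall 0 R)).exists_lipschitzOnWith
    one_ne_zero (convex_closedBall _ _) (isCompact_closedBall _ _)
  rw [absolutelyContinuousOnInterval_iff] at hx ⊢
  intro ε hε
  -- `K + 1` rather than `K`, since the Lipschitz constant may be zero.
  obtain ⟨δ, hδ, h⟩ := hx (ε / (K + 1)) (by positivity)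
  refine ⟨δ, hδ, fun I hI hIδ => ?_⟩
  have hmem : ∀ i ∈ Finset.range I.1, (I.2 i).1 ∈ uIcc a b ∧ (I.2 i).2 ∈ uIcc a b := hI.1
  have hball : ∀ t ∈ uIcc a b, x t ∈ Metric.closedBall (0 : E k) R := fun t ht => by
    simpa using hR t ht
  calc ∑ i ∈ Finset.range I.1, dist (φ (x (I.2 i).1)) (φ (x (I.2 i).2))
      ≤ ∑ i ∈ Finset.range I.1, (K + 1) * dist (x (I.2 i).1) (x (I.2 i).2) := by
        refine Finset.sum_le_sum fun i hi => ?_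
        refine (hK.dist_le_mul _ (hball _ (hmem i hi).1) _ (hball _ (hmem i hi).2)).trans ?_
        gcongr
        linarith
    _ = (K + 1) * ∑ i ∈ Finset.range I.1, dist (x (I.2 i).1) (x (I.2 i).2) := by
        rw [Finset.mul_sum]
    _ < (K + 1) * (ε / (K + 1)) := by
        have := h I hI hIδ
        gcongr
    _ = ε := by field_simp

/-! ### Calculus along absolutely continuous trajectories. -/

namespace IsACSolution

variable {k : ℕ} {x v : ℝ → E k} {φ : E k → ℝ}

theorem continuousOn (hx : IsACSolution x v) : ContinuousOn x (Ici 0) := by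
  intro t ht
  have ht0 : (0 : ℝ) ≤ t := ht
  have h := (hx.1 (t + 1) (by linarith)).continuousOn
  rw [uIcc_of_le (by linarith)] at h
  refine (h t ⟨ht0, by linarith⟩).mono_of_mem_nhdsWithin ?_
  have : Iio (t + 1) ∈ 𝓝 t := Iio_mem_nhds (by linarith)
  filter_upwards [self_mem_nhdsWithin, mem_nhdsWithin_of_mem_nhds this] with s hs hs'
  exact ⟨hs, le_of_lt hs'⟩

theorem ae_hasDerivAt_comp (hx : IsACSolution x v) (hφ : ContDiff ℝ 1 φ) :
    ∀ᵐ t, t ∈ Ici (0 : ℝ) →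
      HasDerivAt (fun s => φ (x s)) (inner ℝ (gradient φ (x t)) (v t)) t := by
  rw [← ae_restrict_iff' measurableSet_Ici]
  filter_upwards [hx.2] with t ht
  have h := (hφ.differentiable one_ne_zero (x t)).hasGradientAt.hasFDerivAt.comp_hasDerivAt t ht
  rwa [InnerProductSpace.toDual_apply_apply] at h

theorem integral_inner_gradient (hx : IsACSolution x v) (hφ : ContDiff ℝ 1 φ) {S : ℝ}
    (hS : 0 ≤ S) :
    ∫ t in (0 : ℝ)..S, inner ℝ (gradient φ (x t)) (v t) = φ (x S) - φ (x 0) := by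
  rw [← ((hx.1 S hS).contDiff_comp hφ).integral_deriv_eq_sub]
  refine intervalIntegral.integral_congr_ae ?_
  filter_upwards [hx.ae_hasDerivAt_comp hφ] with t ht hmem
  rw [uIoc_of_le hS] at hmem
  exact (ht hmem.1.le).deriv.symm

theorem integral_exp_mul (hx : IsACSolution x v) (hφ : ContDiff ℝ 1 φ) (C : ℝ) {S : ℝ}
    (hS : 0 ≤ S) :
    ∫ t in (0 : ℝ)..S, Real.exp (-C * t) *
        (inner ℝ (gradient φ (x t)) (v t) + C * (φ (x 0) - φ (x t))) =
      Real.exp (-C * S) * (φ (x S) - φ (x 0)) := by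
  have hexp : AbsolutelyContinuousOnInterval (fun t => Real.exp (-C * t)) 0 S :=
    ContDiffOn.absolutelyContinuousOnInterval (by fun_prop)
  -- Subtracting `φ (x 0)` removes the boundary term at `0` in the product rule and produces the
  -- term `C * (φ (x 0) - φ (x t))`.
  have hφ' : ContDiff ℝ 1 fun p => φ p - φ (x 0) := hφ.sub contDiff_const
  have h := hexp.integral_deriv_mul_eq_sub ((hx.1 S hS).contDiff_comp hφ')
  simp only [sub_self, mul_zero, sub_zero] at h
  rw [← h]
  refine intervalIntegral.integral_congr_ae ?_
  filter_upwards [hx.ae_hasDerivAt_comp hφ] with t ht hmem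
  rw [uIoc_of_le hS] at hmem
  have h1 : HasDerivAt (fun s => Real.exp (-C * s)) (Real.exp (-C * t) * -C) t := by
    simpa using ((hasDerivAt_id t).const_mul (-C)).exp
  rw [h1.deriv, ((ht hmem.1.le).sub_const _).deriv]
  ring

/-- The discounted integral of `d/dt φ(x(t)) + C (φ(x(0)) - φ(x(t)))` vanishes along a bounded
trajectory. -/
theorem setIntegral_exp_mul_eq_zero (hx : IsACSolution x v) (hφ : ContDiff ℝ 1 φ) {C : ℝ}
    (hC : 0 < C) {s : Set (E k)} (hs : IsCompact s) (hxs : ∀ t, x t ∈ s)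
    (hint : IntegrableOn (fun t => Real.exp (-C * t) *
        (inner ℝ (gradient φ (x t)) (v t) + C * (φ (x 0) - φ (x t)))) (Ici 0)) :
    ∫ t in Ici (0 : ℝ), Real.exp (-C * t) *
        (inner ℝ (gradient φ (x t)) (v t) + C * (φ (x 0) - φ (x t))) = 0 := by
  rw [integral_Ici_eq_integral_Ioi]
  refine tendsto_nhds_unique (intervalIntegral_tendsto_integral_Ioi 0
    (hint.mono_set Ioi_subset_Ici_self) tendsto_id) ?_
  obtain ⟨B, hB⟩ := hs.exists_bound_of_continuousOn hφ.continuous.continuousOn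
  have hexp : Tendsto (fun S : ℝ => Real.exp (-C * S)) atTop (𝓝 0) :=
    Real.tendsto_exp_atBot.comp (tendsto_id.const_mul_atTop_of_neg (neg_lt_zero.2 hC))
  have hlim : Tendsto (fun S : ℝ => Real.exp (-C * S) * (φ (x S) - φ (x 0))) atTop (𝓝 0) := by
    refine hexp.zero_mul_isBoundedUnder_le ⟨B + B, ?_⟩
    simp only [eventually_map, Function.comp_apply]
    exact Eventually.of_forall fun S => (norm_sub_le _ _).trans
      (add_le_add (hB _ (hxs S)) (hB _ (hxs 0)))
  refine hlim.congr' ?_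
  filter_upwards [eventually_ge_atTop 0] with S hS
  exact (hx.integral_exp_mul hφ C hS).symm

end IsACSolution

/-! ### Periodic averages and equality in discounted integrals. -/

/-- If the averages of a function which is `T`-periodic on `[0, ∞)` converge, then the limit is
the average over one period. -/
theorem integral_period_eq_of_tendsto_average {F : ℝ → ℝ} {T L : ℝ} (hT : 0 < T)
    (hF : ∀ τ, 0 ≤ τ → F (τ + T) = F τ)
    (hint : ∀ S, 0 ≤ S → IntervalIntegrable F volume 0 S)
    (hL : Tendsto (fun S : ℝ => S⁻¹ * ∫ τ in (0 : ℝ)..S, F τ) atTop (𝓝 L)) :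
    ∫ τ in (0 : ℝ)..T, F τ = T * L := by
  have hmul : ∀ k : ℕ, ∀ τ, 0 ≤ τ → F (τ + k * T) = F τ := by
    intro k
    induction k with
    | zero => simp
    | succ k ih =>
      intro τ hτ
      rw [← ih τ hτ, ← hF (τ + k * T) (by positivity)]
      push_cast
      ring_nf
  have hsum : ∀ k : ℕ, ∫ τ in (0 : ℝ)..k * T, F τ = k * ∫ τ in (0 : ℝ)..T, F τ := by
    intro k
    induction k with
    | zero => simp
    | succ k ih =>
      have h0 : (0 : ℝ) ≤ k * T := by positivity
      have h1 : (0 : ℝ) ≤ (k + 1 : ℕ) * T := by positivity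
      rw [← intervalIntegral.integral_add_adjacent_intervals (hint _ h0)
        ((hint _ h0).symm.trans (hint _ h1)), ih]
      have hshift : ∫ τ in (k * T : ℝ)..(k + 1 : ℕ) * T, F τ = ∫ τ in (0 : ℝ)..T, F τ := by
        have h2 : ((k + 1 : ℕ) : ℝ) * T = T + k * T := by push_cast; ring
        have h3 := intervalIntegral.integral_comp_add_right (a := 0) (b := T) F (k * T : ℝ)
        rw [zero_add] at h3
        rw [h2, ← h3]
        refine intervalIntegral.integral_congr fun τ hτ => ?_
        rw [uIcc_of_le hT.le] at hτ
        exact hmul k τ hτ.1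
      rw [hshift]
      push_cast
      ring
  have hseq : Tendsto (fun k : ℕ => (k : ℝ) * T) atTop atTop :=
    tendsto_natCast_atTop_atTop.atTop_mul_const hT
  -- Along `S = k * T` with `k > 0` the averages are constant.
  have hconst : Tendsto (fun _ : ℕ => T⁻¹ * ∫ τ in (0 : ℝ)..T, F τ) atTop (𝓝 L) := by
    refine (hL.comp hseq).congr' ?_
    filter_upwards [eventually_gt_atTop 0] with k hk
    have hk' : (k : ℝ) ≠ 0 := by positivity
    simp only [Function.comp_apply, hsum k]
    field_simp
  rw [← tendsto_nhds_unique tendsto_const_nhds hconst]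
  field_simp

/-- If `A + B ≥ C V` while the discounted integrals of `A` and `B` are `V` and `0`, then
`A + B = C V` almost everywhere. -/
theorem ae_add_eq_of_setIntegral_exp_mul {C V : ℝ} (hC : 0 < C) {A B : ℝ → ℝ}
    (hA : IntegrableOn (fun t => Real.exp (-C * t) * A t) (Ici 0))
    (hB : IntegrableOn (fun t => Real.exp (-C * t) * B t) (Ici 0))
    (hAV : ∫ t in Ici (0 : ℝ), Real.exp (-C * t) * A t = V)
    (hB0 : ∫ t in Ici (0 : ℝ), Real.exp (-C * t) * B t = 0) (hle : ∀ t, C * V ≤ A t + B t) :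
    ∀ᵐ t ∂(volume.restrict (Ici (0 : ℝ))), A t + B t = C * V := by
  have hexp : IntegrableOn (fun t => Real.exp (-C * t)) (Ici 0) :=
    (integrableOn_Ici_iff_integrableOn_Ioi (by simp)).2 (exp_neg_integrableOn_Ioi 0 hC)
  -- `C e^{-Ct}` has total mass one on the half-line.
  have hV : ∫ t in Ici (0 : ℝ), Real.exp (-C * t) * (C * V) = V := by
    rw [integral_mul_const, integral_Ici_eq_integral_Ioi,
      integral_exp_mul_Ioi (neg_lt_zero.2 hC)]
    simp only [mul_zero, Real.exp_zero]
    field_simp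
  have hsplit : (fun t => Real.exp (-C * t) * (A t + B t - C * V)) = fun t =>
      Real.exp (-C * t) * A t + Real.exp (-C * t) * B t - Real.exp (-C * t) * (C * V) := by
    ext t
    ring
  have hint : IntegrableOn (fun t => Real.exp (-C * t) * (A t + B t - C * V)) (Ici 0) := by
    rw [hsplit]
    exact (hA.add hB).sub (hexp.mul_const _)
  have hzero : ∫ t in Ici (0 : ℝ), Real.exp (-C * t) * (A t + B t - C * V) = 0 := by
    have hsub := integral_sub (hA.add hB) (hexp.mul_const (C * V))
    simp only [Pi.add_apply] at hsub
    rw [hsplit, hsub, integral_add hA hB, hAV, hB0, hV]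
    ring
  have hnn : ∀ t, 0 ≤ Real.exp (-C * t) * (A t + B t - C * V) := fun t =>
    mul_nonneg (Real.exp_pos _).le (sub_nonneg.2 (hle t))
  filter_upwards [(integral_eq_zero_iff_of_nonneg hnn hint).1 hzero] with t ht
  exact sub_eq_zero.1 ((mul_eq_zero.1 ht).resolve_left (Real.exp_pos _).ne')

theorem _root_.Continuous.integrable_of_compactSpace {X : Type*} [TopologicalSpace X] [CompactSpace X]
    [MeasurableSpace X] [BorelSpace X] {F : Type*} [NormedAddCommGroup F]
    [SecondCountableTopologyEither X F] (μ : Measure X) [IsFiniteMeasure μ] {q : X → F}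
    (hq : Continuous q) : Integrable q μ :=
  hq.integrable_of_hasCompactSupport (HasCompactSupport.of_compactSpace q)

/-! ### Occupational measures and the averaged Hamiltonian. -/

namespace Problem

variable {U : Type*} [MetricSpace U] {m n : ℕ}

instance (P : Problem U m n) : CompactSpace P.Y := isCompact_iff_compactSpace.1 P.isCompact_Y

instance (P : Problem U m n) : CompactSpace P.Z := isCompact_iff_compactSpace.1 P.isCompact_Z

variable (P : Problem U m n)

/-- `(u, y, z) ↦ G(u,y,z) + ∇ζ(z)ᵀ g(u,y,z)`, on `U × Y × Z`. -/
noncomputable def costWithGradient {ζ : E n → ℝ} (hζ : ContDiff ℝ 1 ζ) : C(U × P.Y × P.Z, ℝ) where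
  toFun x := P.G x.1 x.2.1 x.2.2 + inner ℝ (gradient ζ x.2.2) (P.g x.1 x.2.1 x.2.2)
  continuous_toFun := by
    have hι : Continuous fun x : U × P.Y × P.Z => (x.1, (x.2.1 : E m), (x.2.2 : E n)) := by
      fun_prop
    have hζ' := hζ.continuous_gradient
    exact (P.continuous_G.comp hι).add (Continuous.inner (by fun_prop) (P.continuous_g.comp hι))

theorem costWithGradient_apply {ζ : E n → ℝ} (hζ : ContDiff ℝ 1 ζ) (x : U) (y : P.Y) (z : P.Z) :
    P.costWithGradient hζ (x, y, z) = P.G x y z + inner ℝ (gradient ζ z) (P.g x y z) :=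
  rfl

/-- `(u, y) ↦ ∇φ(y)ᵀ f(u,y,z)`, on `U × Y`. -/
noncomputable def fastDerivative {φ : E m → ℝ} (hφ : ContDiff ℝ 1 φ) (z : P.Z) : C(U × P.Y, ℝ) where
  toFun w := inner ℝ (gradient φ w.2) (P.f w.1 w.2 z)
  continuous_toFun := by
    have hι : Continuous fun w : U × P.Y => (w.1, (w.2 : E m), (z : E n)) := by fun_prop
    have hφ' := hφ.continuous_gradient
    exact Continuous.inner (by fun_prop) (P.continuous_f.comp hι)

variable {P}

theorem continuous_G_left (z : P.Z) : Continuous fun w : U × P.Y => P.G w.1 w.2 z :=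
  P.continuous_G.comp (f := fun w : U × P.Y => (w.1, (w.2 : E m), (z : E n))) (by fun_prop)

theorem continuous_g_left (z : P.Z) : Continuous fun w : U × P.Y => P.g w.1 w.2 z :=
  P.continuous_g.comp (f := fun w : U × P.Y => (w.1, (w.2 : E m), (z : E n))) (by fun_prop)

variable [MeasurableSpace U]

/-- The occupational measure generated by an admissible pair belongs to `W(z)`. -/
theorem IsOccupationalMeasure.mem_W {z : P.Z} {u : ℝ → U} {y : ℝ → P.Y}
    {μ : ProbabilityMeasure (U × P.Y)} (hμ : P.IsOccupationalMeasure u y μ)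
    (h : P.IsAssociatedAdmissible z u y) : μ ∈ P.W z := by
  intro φ hφ
  refine tendsto_nhds_unique (hμ (P.fastDerivative hφ z)) ?_
  obtain ⟨B, hB⟩ := P.isCompact_Y.exists_bound_of_continuousOn hφ.continuous.continuousOn
  -- The time average of `∇φᵀf` is the increment of `φ` along `y` divided by `S`, and the increment
  -- is bounded since `Y` is compact.
  have hlim : Tendsto (fun S : ℝ => S⁻¹ * (φ (y S) - φ (y 0))) atTop (𝓝 0) := by
    refine tendsto_inv_atTop_zero.zero_mul_isBoundedUnder_le ⟨B + B, ?_⟩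
    simp only [eventually_map, Function.comp_apply]
    exact Eventually.of_forall fun S => (norm_sub_le _ _).trans
      (add_le_add (hB _ (y S).2) (hB _ (y 0).2))
  refine hlim.congr' ?_
  filter_upwards [eventually_ge_atTop 0] with S hS
  rw [← h.2.integral_inner_gradient hφ hS]
  rfl

theorem IsAssociatedAdmissible.aemeasurable_pair {z : P.Z} {u : ℝ → U} {y : ℝ → P.Y}
    (h : P.IsAssociatedAdmissible z u y) :
    AEMeasurable (fun τ => (u τ, y τ)) (volume.restrict (Ici (0 : ℝ))) :=
  h.1.prodMk ((IsInducing.subtypeVal.continuousOn_iff.2 h.2.continuousOn).aemeasurable measurableSet_Ici)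

variable {z₀ : P.Z} {ζ : E n → ℝ} {u : P.Z → ℝ → U} {y : P.Z → ℝ → P.Y}
  {μ : P.Z → ProbabilityMeasure (U × P.Y)} {zt : ℝ → P.Z}

variable [CompactSpace U]

/-- Discounted integrability along the averaged trajectory of the integral of a continuous
function with respect to the occupational measures. -/
theorem IsACGFamily.integrableOn_exp_mul (h : P.IsACGFamily z₀ u y μ zt)
    (q : C(U × P.Y × P.Z, ℝ)) :
    IntegrableOn (fun t => Real.exp (-P.C * t) *
      ∫ w, q (w.1, w.2, zt t) ∂(μ (zt t) : Measure (U × P.Y))) (Ici 0) := by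
  have hexp : IntegrableOn (fun t => Real.exp (-P.C * t)) (Ici 0) :=
    (integrableOn_Ici_iff_integrableOn_Ioi (by simp)).2 (exp_neg_integrableOn_Ioi 0 P.C_pos)
  have hzt : AEMeasurable zt (volume.restrict (Ici (0 : ℝ))) :=
    (IsInducing.subtypeVal.continuousOn_iff.2 h.solution.2.continuousOn).aemeasurable
      measurableSet_Ici
  refine hexp.mul_bdd (c := ‖q‖)
    ((h.measurable q).comp_aemeasurable hzt).aestronglyMeasurable (Eventually.of_forall fun t => ?_)
  have := norm_integral_le_of_norm_le_const (μ := (μ (zt t) : Measure (U × P.Y)))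
    (Eventually.of_forall fun w : U × P.Y => q.norm_coe_le_norm (w.1, w.2, zt t))
  simpa using this

variable [BorelSpace U]

theorem integral_GTilde_add (μ : ProbabilityMeasure (U × P.Y)) (z : P.Z) (q : E n) :
    ∫ w, (P.G w.1 w.2 z + inner ℝ q (P.g w.1 w.2 z)) ∂(μ : Measure (U × P.Y)) =
      P.GTilde μ z + inner ℝ q (P.gTilde μ z) := by
  have hg : Integrable (fun w : U × P.Y => P.g w.1 w.2 z) (μ : Measure (U × P.Y)) :=
    Continuous.integrable_of_compactSpace _ (continuous_g_left z)
  rw [integral_add (Continuous.integrable_of_compactSpace _ (continuous_G_left z)) (hg.const_inner q),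
    integral_inner hg]
  rfl

theorem HTilde_le {z : P.Z} {μ : ProbabilityMeasure (U × P.Y)} (hμ : μ ∈ P.W z) (q : E n) :
    P.HTilde q z ≤ P.GTilde μ z + inner ℝ q (P.gTilde μ z) := by
  -- A real `sInf` is a lower bound only for sets bounded below; compactness of `U × Y` supplies the
  -- bound.
  refine csInf_le ?_ ⟨μ, hμ, rfl⟩
  have hc : Continuous fun w : U × P.Y => P.G w.1 w.2 z + inner ℝ q (P.g w.1 w.2 z) :=
    (continuous_G_left z).add (continuous_const.inner (continuous_g_left z))
  obtain ⟨B, hB⟩ := isCompact_univ.exists_bound_of_continuousOn hc.continuousOn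
  refine ⟨-B, ?_⟩
  rintro _ ⟨ν, -, rfl⟩
  have h := norm_integral_le_of_norm_le_const (μ := (ν : Measure (U × P.Y)))
    (Eventually.of_forall fun w => hB w (mem_univ w))
  rw [integral_GTilde_add] at h
  simp only [probReal_univ, mul_one] at h
  exact (abs_le.1 h).1

theorem IsAssociatedAdmissible.intervalIntegrable {z : P.Z} {u : ℝ → U} {y : ℝ → P.Y}
    (h : P.IsAssociatedAdmissible z u y) (q : C(U × P.Y, ℝ)) {S : ℝ} (hS : 0 ≤ S) :
    IntervalIntegrable (fun τ => q (u τ, y τ)) volume 0 S := by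
  rw [intervalIntegrable_iff_integrableOn_Icc_of_le hS]
  refine Integrable.of_bound ?_ ‖q‖ (Eventually.of_forall fun τ => q.norm_coe_le_norm _)
  exact ((q.continuous.measurable.comp_aemeasurable h.aemeasurable_pair).mono_measure
    (Measure.restrict_mono Icc_subset_Ici_self le_rfl)).aestronglyMeasurable

/-- Along the trajectory generated by an optimal ACG family, the occupational measures minimize
the averaged Hamiltonian. -/
theorem IsACGFamily.ae_HTilde_eq (h : P.IsACGFamily z₀ u y μ zt)
    (hvalue : P.C * P.averagedValue z₀ = P.averagedLPValue z₀)
    (hζ : P.IsAveragedDualSolution z₀ ζ) (hopt : P.IsOptimalACG z₀ μ zt) :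
    ∀ᵐ t ∂(volume.restrict (Ici (0 : ℝ))),
      P.GTilde (μ (zt t)) (zt t) + inner ℝ (gradient ζ (zt t)) (P.gTilde (μ (zt t)) (zt t)) =
        P.HTilde (gradient ζ (zt t)) (zt t) := by
  have hC := P.C_pos
  obtain ⟨hz0, hsol⟩ := h.solution
  have hι : Continuous fun x : U × P.Y × P.Z => (x.1, (x.2.1 : E m), (x.2.2 : E n)) := by
    fun_prop
  have hcost : IntegrableOn
      (fun t => Real.exp (-P.C * t) * P.GTilde (μ (zt t)) (zt t)) (Ici 0) :=
    h.integrableOn_exp_mul ⟨_, P.continuous_G.comp hι⟩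
  have hH : IntegrableOn (fun t => Real.exp (-P.C * t) * (P.GTilde (μ (zt t)) (zt t) +
      inner ℝ (gradient ζ (zt t)) (P.gTilde (μ (zt t)) (zt t)))) (Ici 0) := by
    simpa only [costWithGradient_apply, integral_GTilde_add] using
      h.integrableOn_exp_mul (P.costWithGradient hζ.1)
  have hdiff : IntegrableOn (fun t => Real.exp (-P.C * t) * (P.C * (ζ (zt 0) - ζ (zt t))))
      (Ici 0) := by
    have := h.integrableOn_exp_mul
      ⟨fun x => P.C * (ζ (zt 0) - ζ x.2.2), by have := hζ.1.continuous; fun_prop⟩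
    simpa using this
  have hder : IntegrableOn (fun t => Real.exp (-P.C * t) *
      (inner ℝ (gradient ζ (zt t)) (P.gTilde (μ (zt t)) (zt t)) +
        P.C * (ζ (zt 0) - ζ (zt t)))) (Ici 0) := by
    -- The term `∇ζᵀg̃` is obtained as the difference of two integrals of continuous functions
    -- against `μ(·|z)`, whose measurability in `z` is part of the ACG property.
    refine ((hH.sub hcost).add hdiff).congr (Eventually.of_forall fun t => ?_)
    simp only [Pi.add_apply, Pi.sub_apply]
    ring
  have hzeroInt := hsol.setIntegral_exp_mul_eq_zero hζ.1 hC P.isCompact_Z (fun t => (zt t).2) hder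
  have hlower : ∀ t, P.HTilde (gradient ζ (zt t)) (zt t) ≤
      P.GTilde (μ (zt t)) (zt t) + inner ℝ (gradient ζ (zt t)) (P.gTilde (μ (zt t)) (zt t)) :=
    fun t => HTilde_le ((h.occupational _).mem_W (h.admissible _)) _
  have hdual : ∀ t, P.C * P.averagedValue z₀ ≤
      P.HTilde (gradient ζ (zt t)) (zt t) + P.C * (ζ (zt 0) - ζ (zt t)) :=
    fun t => by rw [hvalue, hz0]; exact hζ.2 (zt t)
  filter_upwards [ae_add_eq_of_setIntegral_exp_mul hC hcost hder hopt hzeroInt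
    fun t => by linarith [hlower t, hdual t]] with t ht
  -- Equality of the two ends of the chain collapses `hlower`.
  linarith [hlower t, hdual t]

/-- If the occupational measure generated by a periodic admissible pair minimizes the averaged
Hamiltonian, then almost everywhere on the period the control minimizes the dual integrand. -/
theorem IsOccupationalMeasure.ae_isMinOn {z : P.Z} {u : ℝ → U} {y : ℝ → P.Y}
    {μ : ProbabilityMeasure (U × P.Y)} (hμ : P.IsOccupationalMeasure u y μ)
    (h : P.IsAssociatedAdmissible z u y) (hζ : ContDiff ℝ 1 ζ) {η : E m → ℝ}
    (hη : P.IsAssociatedDualSolution ζ z η) {T : ℝ} (hper : IsPeriodicPair T u y)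
    (hmin : P.GTilde μ z + inner ℝ (gradient ζ z) (P.gTilde μ z) = P.HTilde (gradient ζ z) z) :
    ∀ᵐ τ ∂(volume.restrict (Icc (0 : ℝ) T)),
      IsMinOn (fun v : U => P.dualIntegrand ζ η v (y τ) z) univ (u τ) := by
  obtain ⟨hT, hper⟩ := hper
  set H := P.HTilde (gradient ζ z) z
  let c : C(U × P.Y, ℝ) := (P.costWithGradient hζ).comp ⟨fun w => (w.1, w.2, z), by fun_prop⟩
  let q : C(U × P.Y, ℝ) := c + P.fastDerivative hη.1 z
  have hq : ∀ w : U × P.Y, q w = P.dualIntegrand ζ η w.1 w.2 z := fun _ => rfl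
  have hqμ : ∫ w, q w ∂(μ : Measure (U × P.Y)) = H := by
    have h1 : ∫ w, c w ∂(μ : Measure (U × P.Y)) = H :=
      (integral_GTilde_add μ z (gradient ζ z)).trans hmin
    have h2 : ∫ w, P.fastDerivative hη.1 z w ∂(μ : Measure (U × P.Y)) = 0 := hμ.mem_W h η hη.1
    calc ∫ w, q w ∂(μ : Measure (U × P.Y))
        = ∫ w, c w ∂(μ : Measure (U × P.Y)) +
          ∫ w, P.fastDerivative hη.1 z w ∂(μ : Measure (U × P.Y)) :=
          integral_add (Continuous.integrable_of_compactSpace _ c.continuous)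
            (Continuous.integrable_of_compactSpace _ (P.fastDerivative hη.1 z).continuous)
      _ = H := by rw [h1, h2, add_zero]
  have hlim := hμ q
  rw [hqμ] at hlim
  -- Periodicity is essential: a vanishing long-run average of a nonnegative function would not by
  -- itself make it vanish a.e.
  have hperiod := integral_period_eq_of_tendsto_average hT
    (fun τ hτ => by rw [(hper τ hτ).1, (hper τ hτ).2]) (fun S hS => h.intervalIntegrable q hS) hlim
  have hint := h.intervalIntegrable q hT.le
  have hint' : IntegrableOn (fun τ => q (u τ, y τ) - H) (Icc 0 T) :=
    ((intervalIntegrable_iff_integrableOn_Icc_of_le hT.le).1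
      (hint.sub intervalIntegrable_const))
  have hzero : ∫ τ in Icc 0 T, (q (u τ, y τ) - H) = 0 := by
    rw [integral_Icc_eq_integral_Ioc, ← intervalIntegral.integral_of_le hT.le,
      intervalIntegral.integral_sub hint intervalIntegrable_const, hperiod]
    simp
  have hnn : ∀ τ, 0 ≤ q (u τ, y τ) - H := fun τ => sub_nonneg.2 (hη.2 (u τ) (y τ))
  filter_upwards [(integral_eq_zero_iff_of_nonneg hnn hint').1 hzero] with τ hτ v _
  have hτ' : q (u τ, y τ) = H := sub_eq_zero.1 hτ
  rw [hq] at hτ'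
  -- The level `H` does not depend on `v`, so attaining it at `u τ` beats every control at the same
  -- `y τ`.
  exact hτ'.trans_le (hη.2 v (y τ))

end Problem

end SlowFast

theorem mainTheorem8 {U : Type*} [MetricSpace U] [CompactSpace U] [MeasurableSpace U]
    [BorelSpace U] {m n : ℕ} (P : SlowFast.Problem U m n) (z₀ : P.Z)
    (hvalue : P.C * P.averagedValue z₀ = P.averagedLPValue z₀)
    (ζ : SlowFast.E n → ℝ) (hζ : P.IsAveragedDualSolution z₀ ζ)
    (η : P.Z → SlowFast.E m → ℝ) (hη : ∀ z : P.Z, P.IsAssociatedDualSolution ζ z (η z))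
    (u : P.Z → ℝ → U) (y : P.Z → ℝ → P.Y) (μ : P.Z → ProbabilityMeasure (U × P.Y))
    (zt : ℝ → P.Z) (hACG : P.IsACGFamily z₀ u y μ zt)
    (T : P.Z → ℝ)
    (hper : ∀ t : ℝ, 0 ≤ t → SlowFast.IsPeriodicPair (T (zt t)) (u (zt t)) (y (zt t)))
    (hopt : P.IsOptimalACG z₀ μ zt) :
    ∀ᵐ t ∂(volume.restrict (Ici (0 : ℝ))),
      ∀ᵐ τ ∂(volume.restrict (Icc (0 : ℝ) (T (zt t)))),
        IsMinOn (fun v : U => P.dualIntegrand ζ (η (zt t)) v (y (zt t) τ) (zt t)) univ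
          (u (zt t) τ) := by
  filter_upwards [hACG.ae_HTilde_eq hvalue hζ hopt, ae_restrict_mem measurableSet_Ici]
    with t ht ht0
  exact (hACG.occupational _).ae_isMinOn (hACG.admissible _) hζ.1 (hη _) (hper t ht0) ht
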